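/- **Theorem (Perron eigenvalue condition).** Let $d,n\ge 1$ be integers, let $A$ be an expanding real $d\times d$ matrix (every complex eigenvalue of $A$ has modulus $>1$), and let $\mathcal D_{ij}$, $1\le i,j\le n$, be finite (possibly empty) subsets of $\mathbb R^d$. A multiset $X$ in $\mathbb R^d$ is given by its multiplicity function $m_X:\mathbb R^d\to\mathbb Z_{\ge 0}$. It is called a *weak Delone multiset* if there are $r>0$ and a finite $m\ge 1$ such that every open ball of radius $r$ contains at most $m$ points of $X$ counted with multiplicity, and there is $R>0$ such that every closed ball of radius $R$ contains at least one point of $X$. A family $\mathcal X=(X_1,\dots,X_n)$ of multisets in $\mathbb R^d$ solves the *inflation functional equation* with data $(A,\mathcal D_{ij})$ if $X_i=\bigvee_{j=1}^n\bigl(A(X_j)+\mathcal D_{ij}\bigr)$ for $1\le i\le n$, where unions count multiplicity, i.e. $$m_{X_i}(x)=\sum_{j=1}^n\ \sum_{v\in\mathcal D_{ij}} m_{X_j}\bigl(A^{-1}(x-v)\bigr)\qquad\text{for all }x\in\mathbb R^d,\ 1\le i\le n.$$ Suppose that the subdivision matrix $S=[\,|\mathcal D_{ij}|\,]_{1\le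 i,j\le n}$ is primitive (some power $S^k$, $k\ge 1$, has strictly positive entries) and that the inflation functional equation has a solution $\mathcal X=(X_1,\dots,X_n)$ in which every $X_i$ is a weak Delone multiset. Then the Perron eigenvalue $\lambda(S)$ of $S$, that is, the positive real eigenvalue of multiplicity one which is strictly larger than the modulus of every other complex eigenvalue of $S$ and has right and left eigenvectors with positive entries, satisfies $$\lambda(S)=|\det A|.$$ -/

import Mathlib

open scoped Matrix

namespace Inflation

/-- `ℝ^d` with the Euclidean norm. -/
abbrev Pt (d : ℕ) : Type := EuclideanSpace ℝ (Fin d)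

/-- A multiset in `ℝ^d`, given by its multiplicity function extended by `0` off the underlying
set. All multiplicities are finite; the underlying set is arbitrary. -/
abbrev PointMultiset (d : ℕ) : Type := Pt d → ℕ

/-- An `n`-multiset family `(X_1, …, X_n)`. -/
abbrev MultisetFamily (d n : ℕ) : Type := Fin n → PointMultiset d

/-- The real square matrix `A` is expanding: every complex eigenvalue has modulus `> 1`. -/
def IsExpanding {d : ℕ} (A : Matrix (Fin d) (Fin d) ℝ) : Prop :=
  ∀ z ∈ spectrum ℂ (A.map ((↑) : ℝ → ℂ)), 1 < ‖z‖

/-- The image multiset `A(X)` under an invertible matrix `A`, with multiplicity function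
`m_{A(X)}(y) = m_X(A⁻¹ y)`. It is only used for expanding matrices, which are invertible. -/
noncomputable def PointMultiset.image {d : ℕ} (A : Matrix (Fin d) (Fin d) ℝ)
    (X : PointMultiset d) : PointMultiset d :=
  fun y => X (Matrix.toEuclideanLin A⁻¹ y)

/-- The multiset sum `X + D = ⋁_{v ∈ D} (X + v)` of a multiset and a finite set, with multiplicity
function `m_{X + D}(x) = ∑_{v ∈ D} m_X(x - v)`. -/
def PointMultiset.addSet {d : ℕ} (X : PointMultiset d) (D : Finset (Pt d)) : PointMultiset d :=
  fun x => ∑ v ∈ D, X (x - v)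

/-- The inflation operator `ψ`, with `ψ(X)_i = ⋁_j (A(X_j) + D_{ij})`; the multiset union adds
multiplicities. -/
noncomputable def inflate {d n : ℕ} (A : Matrix (Fin d) (Fin d) ℝ)
    (D : Fin n → Fin n → Finset (Pt d)) (X : MultisetFamily d n) : MultisetFamily d n :=
  fun i x => ∑ j, ((X j).image A).addSet (D i j) x

/-- The subdivision matrix `S = [|D_{ij}|]`. -/
def subdivisionMatrix {d n : ℕ} (D : Fin n → Fin n → Finset (Pt d)) :
    Matrix (Fin n) (Fin n) ℝ :=
  Matrix.of fun i j => ((D i j).card : ℝ)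

/-- Some radius `r > 0` and finite bound `m` are such that every open ball of radius `r` contains
at most `m` points of `X`, counted with multiplicity. -/
def IsWeaklyUniformlyDiscrete {d : ℕ} (X : PointMultiset d) : Prop :=
  ∃ r : ℝ, 0 < r ∧ ∃ m : ℕ, 1 ≤ m ∧ ∀ c : Pt d, ∀ F : Finset (Pt d),
    (F : Set (Pt d)) ⊆ Metric.ball c r → ∑ x ∈ F, X x ≤ m

/-- For some radius `R > 0` every closed ball of radius `R` contains a point of `X`. -/
def IsRelativelyDense {d : ℕ} (X : PointMultiset d) : Prop :=
  ∃ R : ℝ, 0 < R ∧ ∀ c : Pt d, ∃ x ∈ Metric.closedBall c R, 0 < X x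

/-- A weak Delone multiset. -/
structure IsWeakDelone {d : ℕ} (X : PointMultiset d) : Prop where
  weaklyUniformlyDiscrete : IsWeaklyUniformlyDiscrete X
  relativelyDense : IsRelativelyDense X

/-- A weak Delone multiset family for the data `(A, D_{ij})`: a solution of the inflation
functional equation all of whose members are weak Delone multisets. -/
structure IsWeakDeloneFamily {d n : ℕ} (A : Matrix (Fin d) (Fin d) ℝ)
    (D : Fin n → Fin n → Finset (Pt d)) (X : MultisetFamily d n) : Prop where
  inflate_eq : inflate A D X = X
  isWeakDelone : ∀ i, IsWeakDelone (X i)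

/-- `l` is the Perron eigenvalue of `M`: a positive real eigenvalue of (algebraic) multiplicity one
which strictly dominates the modulus of every other complex eigenvalue, and which has a right and a
left eigenvector with positive entries. -/
structure IsPerronEigenvalue {n : ℕ} (M : Matrix (Fin n) (Fin n) ℝ) (l : ℝ) : Prop where
  pos : 0 < l
  multiplicity_one : M.charpoly.rootMultiplicity l = 1
  dominant : ∀ z ∈ spectrum ℂ (M.map ((↑) : ℝ → ℂ)), z ≠ (l : ℂ) → ‖z‖ < l
  right_eigenvector : ∃ v : Fin n → ℝ, (∀ i, 0 < v i) ∧ M *ᵥ v = l • v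
  left_eigenvector : ∃ w : Fin n → ℝ, (∀ i, 0 < w i) ∧ w ᵥ* M = l • w

/-- A matrix has at most one Perron eigenvalue. -/
theorem IsPerronEigenvalue.unique {n : ℕ} {M : Matrix (Fin n) (Fin n) ℝ} {l l' : ℝ}
    (h : IsPerronEigenvalue M l) (h' : IsPerronEigenvalue M l') : l = l' := by
  have hn : Nonempty (Fin n) := by
    by_contra hne
    rw [not_nonempty_iff] at hne
    have h1 := h.multiplicity_one
    rw [Matrix.charpoly, Matrix.det_isEmpty, ← Polynomial.C_1, Polynomial.rootMultiplicity_C] at h1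
    exact zero_ne_one h1
  obtain ⟨v, hv, hMv⟩ := h.right_eigenvector
  obtain ⟨w, hw, hwM⟩ := h'.left_eigenvector
  have e : w ⬝ᵥ (M *ᵥ v) = (w ᵥ* M) ⬝ᵥ v := Matrix.dotProduct_mulVec w M v
  rw [hMv, hwM, dotProduct_smul, smul_dotProduct] at e
  have hpos : 0 < w ⬝ᵥ v :=
    Finset.sum_pos (fun i _ => mul_pos (hw i) (hv i)) Finset.univ_nonempty
  exact mul_right_cancel₀ hpos.ne' (by simpa using e)

end Inflation

/-!
Let `λ` be the Perron eigenvalue of the subdivision matrix `S` and `v` its positive right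
eigenvector. The idea is to count, with multiplicity, the points of `X i` in the translates of the
ball of radius `ρ` inflated by `A ^ k`, and to let `k` tend to infinity.

* The functional equation expresses the number of points of `X i` in a set inflated by `A ^ (k + 1)`
  as a sum, over `j` and over `D i j`, of numbers of points of `X j` in sets inflated by `A ^ k`
  (`count_region_succ`). Bounds proportional to `v i` that are uniform in the translation therefore
  propagate with a factor `λ` at each step (`count_region_le_pow`, `pow_le_count_region`).
* The weak Delone property makes the same numbers comparable to the volume of the inflated ball,
  hence to `|det A| ^ k`: from above by double counting, from below by covering
  (`IsWeakDelone.exists_count_region_bounds`). Both arguments enlarge the inflated ball by a bounded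
  amount; as the powers of `A⁻¹` are bounded (`IsExpanding.exists_norm_pow_inv_le`), this costs only
  a bounded change of `ρ`.

Comparing the two growth rates gives `λ = |det A|` (`IsWeakDeloneFamily.eq_abs_det`).

The Perron–Frobenius theorem for primitive matrices is proved along the way. Positive eigenvectors
come from the Collatz–Wielandt variational principle. Simplicity and strict dominance both follow
from one estimate, `Matrix.IsPrimitive.norm_lt_of_eigenvector`: eigenvectors annihilated by the
positive left eigenvector `w` have eigenvalues of modulus smaller than `λ`.
-/

open scoped ENNReal
open MeasureTheory Filter

/-! ### Perron–Frobenius theory of primitive matrices -/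

namespace Matrix

variable {ι : Type*} [Fintype ι]

lemma mulVec_pos_of_pos {P : Matrix ι ι ℝ} (hP : ∀ i j, 0 < P i j) {z : ι → ℝ}
    (hz : 0 ≤ z) (hz0 : z ≠ 0) (i : ι) : 0 < (P *ᵥ z) i := by
  obtain ⟨j, hj⟩ := Function.ne_iff.mp hz0
  exact Finset.sum_pos' (fun j _ => mul_nonneg (hP i j).le (hz j))
    ⟨j, Finset.mem_univ j, mul_pos (hP i j) (lt_of_le_of_ne (hz j) (Ne.symm hj))⟩

variable [DecidableEq ι]

lemma pow_mulVec_eq_smul {S : Matrix ι ι ℝ} {t : ℝ} {x : ι → ℝ} (h : S *ᵥ x = t • x) (k : ℕ) :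
    (S ^ k) *ᵥ x = t ^ k • x := by
  induction k with
  | zero => simp
  | succ k ih => rw [pow_succ, ← mulVec_mulVec, h, mulVec_smul, ih, smul_smul, pow_succ']

/-- The Collatz–Wielandt argument: the largest `t` such that `t • x ≤ S *ᵥ x` for some probability
vector `x` is attained, and an `x` attaining it is an eigenvector. -/
lemma IsPrimitive.exists_pos_eigenvector [Nonempty ι] {S : Matrix ι ι ℝ} (hS : S.IsPrimitive) :
    ∃ t : ℝ, 0 < t ∧ ∃ v : ι → ℝ, (∀ i, 0 < v i) ∧ S *ᵥ v = t • v := by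
  obtain ⟨hnn, k, hk, hP⟩ := hS
  let K : Set (ℝ × (ι → ℝ)) :=
    (Set.Icc 0 (∑ i, ∑ j, S i j) ×ˢ stdSimplex ℝ ι) ∩ {p | p.1 • p.2 ≤ S *ᵥ p.2}
  have hK : IsCompact K := by
    refine (isCompact_Icc.prod (isCompact_stdSimplex ℝ ι)).inter_right ?_
    exact isClosed_le (by fun_prop) (by fun_prop)
  have hKne : K.Nonempty := by
    obtain ⟨x, hx⟩ := (inferInstance : Nonempty (stdSimplex ℝ ι))
    refine ⟨(0, x), ⟨⟨le_rfl, Finset.sum_nonneg fun i _ => Finset.sum_nonneg fun j _ => hnn i j⟩,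
      hx⟩, ?_⟩
    intro i
    change (0 : ℝ) * x i ≤ (S *ᵥ x) i
    rw [zero_mul]
    exact Finset.sum_nonneg fun j _ => mul_nonneg (hnn i j) (hx.1 j)
  obtain ⟨⟨t, x⟩, ⟨⟨⟨ht0, -⟩, hx⟩, htx⟩, hmax⟩ := hK.exists_isMaxOn hKne continuousOn_fst
  replace htx : t • x ≤ S *ᵥ x := htx
  replace ht0 : 0 ≤ t := ht0
  replace hx : x ∈ stdSimplex ℝ ι := hx
  have hx0 : x ≠ 0 := by
    rintro rfl
    simpa using hx.2
  have key : ∀ (s : ℝ) (y : ι → ℝ), 0 ≤ s → (∀ i, 0 < y i) → s • y ≤ S *ᵥ y → s ≤ t := by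
    intro s y hs hy hsy
    have hc : 0 < ∑ i, y i := Finset.sum_pos (fun i _ => hy i) Finset.univ_nonempty
    have hmem : (∑ i, y i)⁻¹ • y ∈ stdSimplex ℝ ι := by
      refine ⟨fun i => mul_nonneg (inv_nonneg.mpr hc.le) (hy i).le, ?_⟩
      simp only [Pi.smul_apply, smul_eq_mul, ← Finset.mul_sum]
      exact inv_mul_cancel₀ hc.ne'
    have hle : s • (∑ i, y i)⁻¹ • y ≤ S *ᵥ ((∑ i, y i)⁻¹ • y) := by
      rw [mulVec_smul, smul_comm]
      exact smul_le_smul_of_nonneg_left hsy (inv_nonneg.mpr hc.le)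
    generalize (∑ i, y i)⁻¹ • y = u at hmem hle
    refine hmax (show (s, u) ∈ K from ⟨⟨⟨hs, ?_⟩, hmem⟩, hle⟩)
    calc s = ∑ i, s * u i := by rw [← Finset.mul_sum, hmem.2, mul_one]
      _ ≤ ∑ i, ∑ j, S i j * u j := Finset.sum_le_sum fun i _ => hle i
      _ ≤ ∑ i, ∑ j, S i j := by
        gcongr with i _ j _
        refine mul_le_of_le_one_right (hnn i j) ?_
        exact (mem_Icc_of_mem_stdSimplex hmem j).2
  have hy : ∀ i, 0 < ((S ^ k) *ᵥ x) i := mulVec_pos_of_pos hP hx.1 hx0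
  have hSx : S *ᵥ x = t • x := by
    by_contra hne
    have hz := mulVec_pos_of_pos hP (sub_nonneg.mpr htx) (sub_ne_zero.mpr hne)
    -- If `S x ≠ t x`, then `t y < S y` in every entry for `y = S ^ k x`, so `t` can be increased.
    have hcomm : (S ^ k) *ᵥ (S *ᵥ x - t • x) = S *ᵥ ((S ^ k) *ᵥ x) - t • ((S ^ k) *ᵥ x) := by
      rw [mulVec_sub, mulVec_smul, mulVec_mulVec, mulVec_mulVec, ← pow_succ, ← pow_succ']
    rw [hcomm] at hz
    generalize (S ^ k) *ᵥ x = y at hy hz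
    obtain ⟨i₀, hi₀⟩ := Finite.exists_min fun i => (S *ᵥ y - t • y) i / y i
    have hδ : 0 < (S *ᵥ y - t • y) i₀ / y i₀ := div_pos (hz i₀) (hy i₀)
    have := key (t + (S *ᵥ y - t • y) i₀ / y i₀) y (by positivity) hy (fun i => by
      have := (le_div_iff₀ (hy i)).mp (hi₀ i)
      simp only [Pi.sub_apply, Pi.smul_apply, smul_eq_mul, add_mul] at this ⊢
      linarith)
    linarith
  have hPx := pow_mulVec_eq_smul hSx k
  rw [hPx] at hy
  have htk : 0 < t := by
    refine lt_of_le_of_ne ht0 ?_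
    rintro rfl
    simpa [zero_pow hk.ne'] using hy (Classical.arbitrary ι)
  exact ⟨t, htk, x, fun i => pos_of_mul_pos_right (hy i) (pow_pos htk k).le, hSx⟩

lemma IsPrimitive.exists_left_right_eigenvectors [Nonempty ι] {S : Matrix ι ι ℝ}
    (hS : S.IsPrimitive) :
    ∃ t : ℝ, 0 < t ∧ (∃ v : ι → ℝ, (∀ i, 0 < v i) ∧ S *ᵥ v = t • v) ∧
      ∃ w : ι → ℝ, (∀ i, 0 < w i) ∧ w ᵥ* S = t • w := by
  obtain ⟨t, ht, v, hv, hSv⟩ := hS.exists_pos_eigenvector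
  have hT : Sᵀ.IsPrimitive := by
    obtain ⟨hnn, k, hk, hP⟩ := hS
    exact ⟨fun i j => hnn j i, k, hk, fun i j => by rw [← transpose_pow]; exact hP j i⟩
  obtain ⟨t', -, w, hw, hSw⟩ := hT.exists_pos_eigenvector
  rw [mulVec_transpose] at hSw
  have e : w ⬝ᵥ (S *ᵥ v) = (w ᵥ* S) ⬝ᵥ v := dotProduct_mulVec w S v
  rw [hSv, hSw, dotProduct_smul, smul_dotProduct] at e
  have hpos : 0 < w ⬝ᵥ v := Finset.sum_pos (fun i _ => mul_pos (hw i) (hv i)) Finset.univ_nonempty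
  obtain rfl : t = t' := mul_right_cancel₀ hpos.ne' (by simpa using e)
  exact ⟨t, ht, ⟨v, hv, hSv⟩, w, hw, hSw⟩

/-- The spectral gap. With `w` a positive left eigenvector, `v` any positive vector and
`P = S ^ k` entrywise positive, `P - ε • v wᵀ` is still nonnegative for small `ε > 0`; it agrees
with `P` on the annihilator of `w`, and has `w` as left eigenvector for the strictly smaller
eigenvalue `t ^ k - ε * (w ⬝ᵥ v)`. -/
lemma IsPrimitive.norm_lt_of_eigenvector [Nonempty ι] {S : Matrix ι ι ℝ} (hS : S.IsPrimitive)
    {t : ℝ} (ht : 0 < t) {v w : ι → ℝ} (hv : ∀ i, 0 < v i)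
    (hw : ∀ i, 0 < w i) (hwS : w ᵥ* S = t • w) {z : ℂ} {x : ι → ℂ} (hx0 : x ≠ 0)
    (hx : S.map ((↑) : ℝ → ℂ) *ᵥ x = z • x) (hwx : ∑ i, (w i : ℂ) * x i = 0) : ‖z‖ < t := by
  obtain ⟨hnn, k, hk, hP⟩ := hS
  have hPw : ∀ j, ∑ i, w i * (S ^ k) i j = t ^ k * w j := fun j => by
    have h := pow_mulVec_eq_smul (S := Sᵀ) (by rwa [mulVec_transpose]) k
    rw [← transpose_pow, mulVec_transpose] at h
    exact congrFun h j
  have hPx : ∀ i, ∑ j, ((S ^ k) i j : ℂ) * x j = z ^ k * x i := fun i => by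
    have h : ((S.map ((↑) : ℝ → ℂ)) ^ k) *ᵥ x = z ^ k • x := by
      clear hk hP hPw
      induction k with
      | zero => simp
      | succ k ih => rw [pow_succ, ← mulVec_mulVec, hx, mulVec_smul, ih, smul_smul, pow_succ']
    have h' : (S.map ((↑) : ℝ → ℂ)) ^ k = (S ^ k).map ((↑) : ℝ → ℂ) :=
      (map_pow Complex.ofRealHom.mapMatrix S k).symm
    rw [h'] at h
    exact congrFun h i
  obtain ⟨⟨i₀, j₀⟩, hmin⟩ := Finite.exists_min fun p : ι × ι => (S ^ k) p.1 p.2 / (v p.1 * w p.2)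
  set ε : ℝ := (S ^ k) i₀ j₀ / (v i₀ * w j₀)
  have hε : 0 < ε := div_pos (hP _ _) (mul_pos (hv _) (hw _))
  have hQ : ∀ i j, 0 ≤ (S ^ k) i j - ε * (v i * w j) := fun i j =>
    sub_nonneg.mpr ((le_div_iff₀ (mul_pos (hv i) (hw j))).mp (hmin (i, j)))
  have hbound : ∀ i, ‖z‖ ^ k * ‖x i‖ ≤ ∑ j, ((S ^ k) i j - ε * (v i * w j)) * ‖x j‖ := fun i => by
    have h : z ^ k * x i = ∑ j, (((S ^ k) i j - ε * (v i * w j) : ℝ) : ℂ) * x j := by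
      have h2 : ∑ j, (ε * (v i * w j) : ℂ) * x j = (ε * v i) * ∑ j, (w j : ℂ) * x j := by
        rw [Finset.mul_sum]
        exact Finset.sum_congr rfl fun j _ => by ring
      push_cast
      simp_rw [sub_mul, Finset.sum_sub_distrib]
      rw [h2, hwx, mul_zero, sub_zero, hPx]
    rw [← norm_pow, ← norm_mul, h]
    refine (norm_sum_le _ _).trans (Finset.sum_le_sum fun j _ => ?_)
    rw [norm_mul, Complex.norm_real, Real.norm_of_nonneg (hQ i j)]
  have hwv : 0 < ∑ i, w i * v i :=
    Finset.sum_pos (fun i _ => mul_pos (hw i) (hv i)) Finset.univ_nonempty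
  have hwn : 0 < ∑ i, w i * ‖x i‖ := by
    obtain ⟨j, hj⟩ := Function.ne_iff.mp hx0
    exact Finset.sum_pos' (fun i _ => mul_nonneg (hw i).le (norm_nonneg _))
      ⟨j, Finset.mem_univ j, mul_pos (hw j) (norm_pos_iff.mpr hj)⟩
  have hmain : ‖z‖ ^ k * ∑ i, w i * ‖x i‖ ≤
      (t ^ k - ε * ∑ i, w i * v i) * ∑ i, w i * ‖x i‖ := by
    calc ‖z‖ ^ k * ∑ i, w i * ‖x i‖ = ∑ i, w i * (‖z‖ ^ k * ‖x i‖) := by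
          rw [Finset.mul_sum]
          exact Finset.sum_congr rfl fun i _ => by ring
      _ ≤ ∑ i, w i * ∑ j, ((S ^ k) i j - ε * (v i * w j)) * ‖x j‖ :=
          Finset.sum_le_sum fun i _ => mul_le_mul_of_nonneg_left (hbound i) (hw i).le
      _ = ∑ j, (∑ i, w i * (S ^ k) i j - ε * (∑ i, w i * v i) * w j) * ‖x j‖ := by
          simp_rw [Finset.mul_sum]
          rw [Finset.sum_comm]
          refine Finset.sum_congr rfl fun j _ => ?_
          rw [Finset.sum_mul, ← Finset.sum_sub_distrib, Finset.sum_mul]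
          exact Finset.sum_congr rfl fun i _ => by ring
      _ = _ := by
          simp_rw [hPw]
          generalize ∑ i, w i * v i = c
          rw [Finset.mul_sum]
          exact Finset.sum_congr rfl fun j _ => by ring
  have hlt : ‖z‖ ^ k < t ^ k :=
    (le_of_mul_le_mul_right hmain hwn).trans_lt (sub_lt_self _ (mul_pos hε hwv))
  exact lt_of_pow_lt_pow_left₀ k ht.le hlt

/-- The generalized eigenspace of the Perron eigenvalue is spanned by the positive eigenvector,
because the matrix minus the eigenvalue is injective on the annihilator of `w`. -/
lemma IsPrimitive.rootMultiplicity_charpoly [Nonempty ι] {S : Matrix ι ι ℝ} (hS : S.IsPrimitive)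
    {t : ℝ} (ht : 0 < t) {v w : ι → ℝ} (hv : ∀ i, 0 < v i) (hSv : S *ᵥ v = t • v)
    (hw : ∀ i, 0 < w i) (hwS : w ᵥ* S = t • w) : S.charpoly.rootMultiplicity t = 1 := by
  set f : Module.End ℝ (ι → ℝ) := toLin' S with hf
  have hinj : ∀ (m : ℕ) (u : ι → ℝ), w ⬝ᵥ u = 0 → ((f - algebraMap ℝ _ t) ^ m) u = 0 → u = 0 := by
    intro m
    induction m with
    | zero => intro u _ h; simpa using h
    | succ m ih =>
      intro u hwu h
      have hu : (f - algebraMap ℝ _ t) u = 0 := by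
        refine ih _ ?_ (by rwa [pow_succ] at h)
        simp [hf, dotProduct_sub, dotProduct_mulVec, hwS, hwu]
      have hSu : S *ᵥ u = t • u := by simpa [hf, sub_eq_zero] using hu
      by_contra hu0
      refine lt_irrefl t ?_
      have hx0 : (fun i => (u i : ℂ)) ≠ 0 := fun h0 =>
        hu0 (funext fun i => by simpa using congrFun h0 i)
      have := hS.norm_lt_of_eigenvector ht hv hw hwS (z := (t : ℂ)) hx0
        (funext fun i => by
          have := congrArg ((↑) : ℝ → ℂ) (congrFun hSu i)
          simpa [mulVec, dotProduct] using this)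
        (by
          have := congrArg ((↑) : ℝ → ℂ) hwu
          simpa [dotProduct] using this)
      rwa [Complex.norm_real, Real.norm_of_nonneg ht.le] at this
  have hwv : 0 < w ⬝ᵥ v := Finset.sum_pos (fun i _ => mul_pos (hw i) (hv i)) Finset.univ_nonempty
  have hfv : (f - algebraMap ℝ _ t) v = 0 := by simp [hf, hSv]
  have hspan : f.maxGenEigenspace t = Submodule.span ℝ {v} := by
    refine le_antisymm (fun u hu => ?_) ?_
    · obtain ⟨m, hm⟩ := (Module.End.mem_maxGenEigenspace f t u).mp hu
      rw [← Algebra.algebraMap_eq_smul_one] at hm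
      -- Subtract from `u` the multiple of `v` that brings it into the annihilator of `w`.
      have h0 : u - ((w ⬝ᵥ u) / (w ⬝ᵥ v)) • v = 0 := by
        refine hinj (m + 1) _ ?_ ?_
        · rw [dotProduct_sub, dotProduct_smul, smul_eq_mul, div_mul_cancel₀ _ hwv.ne', sub_self]
        · have hu0 : ((f - algebraMap ℝ _ t) ^ (m + 1)) u = 0 := by
            rw [pow_succ', Module.End.mul_apply, hm, map_zero]
          have hv0 : ((f - algebraMap ℝ _ t) ^ (m + 1)) v = 0 := by
            rw [pow_succ, Module.End.mul_apply, hfv, map_zero]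
          rw [map_sub, map_smul, hu0, hv0, smul_zero, sub_zero]
      exact Submodule.mem_span_singleton.mpr ⟨_, (sub_eq_zero.mp h0).symm⟩
    · rw [Submodule.span_singleton_le_iff_mem, Module.End.mem_maxGenEigenspace]
      exact ⟨1, by rw [← Algebra.algebraMap_eq_smul_one, pow_one, hfv]⟩
  have hv0 : v ≠ 0 := fun h => (hv (Classical.arbitrary ι)).ne' (congrFun h _)
  rw [← charpoly_toLin', ← LinearMap.finrank_maxGenEigenspace_eq, hspan, finrank_span_singleton hv0]

end Matrix

namespace Inflation

theorem isPerronEigenvalue_of_isPrimitive {n : ℕ} [NeZero n] {S : Matrix (Fin n) (Fin n) ℝ}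
    (hS : S.IsPrimitive) {t : ℝ} (ht : 0 < t) {v w : Fin n → ℝ} (hv : ∀ i, 0 < v i)
    (hSv : S *ᵥ v = t • v) (hw : ∀ i, 0 < w i) (hwS : w ᵥ* S = t • w) :
    IsPerronEigenvalue S t := by
  refine ⟨ht, hS.rootMultiplicity_charpoly ht hv hSv hw hwS, fun z hz hzt => ?_, ⟨v, hv, hSv⟩,
    ⟨w, hw, hwS⟩⟩
  rw [← Matrix.spectrum_toLin', ← Module.End.hasEigenvalue_iff_mem_spectrum] at hz
  obtain ⟨x, hx⟩ := hz.exists_hasEigenvector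
  have hSx : S.map ((↑) : ℝ → ℂ) *ᵥ x = z • x := by simpa using hx.apply_eq_smul
  refine hS.norm_lt_of_eigenvector ht hv hw hwS hx.2 hSx ?_
  -- Left and right eigenvectors for different eigenvalues are orthogonal.
  have hwS' : (fun i => (w i : ℂ)) ᵥ* S.map ((↑) : ℝ → ℂ) = (t : ℂ) • fun i => (w i : ℂ) :=
    funext fun i => by
      have := congrArg ((↑) : ℝ → ℂ) (congrFun hwS i)
      simpa [Matrix.vecMul, dotProduct] using this
  have e := Matrix.dotProduct_mulVec (fun i => (w i : ℂ)) (S.map ((↑) : ℝ → ℂ)) x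
  rw [hSx, hwS', dotProduct_smul, smul_dotProduct, smul_eq_mul, smul_eq_mul] at e
  exact (mul_eq_mul_right_iff.mp e).resolve_left hzt

end Inflation

/-! ### Expanding matrices -/

namespace Inflation

variable {d : ℕ}

lemma IsExpanding.isUnit_map {A : Matrix (Fin d) (Fin d) ℝ} (hA : IsExpanding A) :
    IsUnit (A.map ((↑) : ℝ → ℂ)) := by
  rw [← spectrum.zero_notMem_iff ℂ]
  intro h
  have := hA 0 h
  rw [norm_zero] at this
  exact absurd this (not_lt.mpr zero_le_one)

lemma IsExpanding.det_ne_zero {A : Matrix (Fin d) (Fin d) ℝ} (hA : IsExpanding A) :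
    A.det ≠ 0 := by
  have h := ((Matrix.isUnit_iff_isUnit_det _).mp hA.isUnit_map).ne_zero
  have h' : (A.map ((↑) : ℝ → ℂ)).det = A.det := (RingHom.map_det Complex.ofRealHom A).symm
  rw [h'] at h
  exact_mod_cast h

/-- The powers of the inverse of an expanding matrix are uniformly bounded, by Gelfand's spectral
radius formula over `ℂ`. -/
lemma IsExpanding.exists_norm_pow_inv_le (hd : 0 < d) {A : Matrix (Fin d) (Fin d) ℝ}
    (hA : IsExpanding A) :
    ∃ M : ℝ, 0 ≤ M ∧ ∀ (k : ℕ) (x : Pt d), ‖(Matrix.toEuclideanLin A⁻¹ ^ k) x‖ ≤ M * ‖x‖ := by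
  have : NeZero d := ⟨hd.ne'⟩
  have hunit := hA.isUnit_map
  have hinv : (A.map ((↑) : ℝ → ℂ))⁻¹ = A⁻¹.map ((↑) : ℝ → ℂ) := by
    refine Matrix.inv_eq_right_inv ?_
    have h : A * A⁻¹ = 1 := Matrix.mul_nonsing_inv A hA.det_ne_zero.isUnit
    have := congrArg (Complex.ofRealHom.mapMatrix) h
    rwa [map_mul, map_one] at this
  set T := Matrix.toEuclideanCLM (n := Fin d) (𝕜 := ℂ) (A⁻¹.map ((↑) : ℝ → ℂ)) with hT
  have hspec : ∀ z ∈ spectrum ℂ T, ‖z‖₊ < 1 := by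
    intro z hz
    have hz' : z ∈ spectrum ℂ (A⁻¹.map ((↑) : ℝ → ℂ)) := by
      rwa [hT, AlgEquiv.spectrum_eq] at hz
    rw [← hinv, ← hunit.unit_spec, ← Matrix.coe_units_inv, ← spectrum.inv₀_mem_iff,
      hunit.unit_spec] at hz'
    have h1 := hA _ hz'
    rw [norm_inv] at h1
    by_contra hlt
    exact absurd h1 (not_lt.mpr (inv_le_one_of_one_le₀ (not_lt.mp hlt)))
  have hlt := spectrum.spectralRadius_lt_of_forall_lt T hspec
  have hev : ∀ᶠ k : ℕ in atTop, ‖T ^ k‖ ≤ 1 := by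
    filter_upwards [(spectrum.pow_norm_pow_one_div_tendsto_nhds_spectralRadius T).eventually
      (gt_mem_nhds hlt), eventually_gt_atTop 0] with k hk hk0
    have h2 : ‖T ^ k‖ ^ (1 / (k : ℝ)) < 1 := by simpa using hk
    by_contra hgt
    exact absurd h2 (not_lt.mpr (Real.one_le_rpow (not_le.mp hgt).le (by positivity)))
  obtain ⟨M, hM⟩ := (isBoundedUnder_of_eventually_le hev).bddAbove_range
  have hTk : ∀ k, ‖T ^ k‖ ≤ M := fun k => hM ⟨k, rfl⟩
  refine ⟨M, (norm_nonneg _).trans (hTk 0), fun k x => ?_⟩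
  -- Complexification of vectors is isometric and intertwines `A⁻¹` with `T`.
  let J : Pt d → EuclideanSpace ℂ (Fin d) := fun x => WithLp.toLp 2 fun i => (x i : ℂ)
  have hJ : ∀ x, ‖J x‖ = ‖x‖ := fun x => by simp [J, EuclideanSpace.norm_eq]
  have hJT : ∀ x, J (Matrix.toEuclideanLin A⁻¹ x) = T (J x) := fun x => by
    ext i
    simp [J, hT, Matrix.mulVec, dotProduct]
  have hJk : J ((Matrix.toEuclideanLin A⁻¹ ^ k) x) = (T ^ k) (J x) := by
    induction k with
    | zero => rfl
    | succ k ih =>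
      rw [pow_succ', pow_succ', Module.End.mul_apply, hJT, ih]
      rfl
  rw [← hJ, hJk, ← hJ x]
  exact (T ^ k).le_of_opNorm_le (hTk k) _

/-! ### Counting points in inflated balls -/

/-- The number of points of the multiset `X` in the set `E`, counted with multiplicity. -/
noncomputable def count (X : PointMultiset d) (E : Set (Pt d)) : ℝ≥0∞ :=
  ∑' x, E.indicator (fun x => (X x : ℝ≥0∞)) x

/-- The translate by `c` of the preimage under `T ^ k` of the closed ball of radius `ρ`. For
`T = A⁻¹` this is the ball inflated by `A ^ k`. -/
def region (T : Pt d →ₗ[ℝ] Pt d) (k : ℕ) (ρ : ℝ) (c : Pt d) : Set (Pt d) :=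
  {x | ‖(T ^ k) (x - c)‖ ≤ ρ}

lemma region_zero (T : Pt d →ₗ[ℝ] Pt d) (ρ : ℝ) (c : Pt d) :
    region T 0 ρ c = Metric.closedBall c ρ := by
  ext x
  simp [region, dist_eq_norm]

lemma measurableSet_region (T : Pt d →ₗ[ℝ] Pt d) (k : ℕ) (ρ : ℝ) (c : Pt d) :
    MeasurableSet (region T k ρ c) := by
  have : Continuous (T ^ k) := (T ^ k).continuous_of_finiteDimensional
  exact (isClosed_le (by fun_prop) continuous_const).measurableSet

lemma volume_region {T : Pt d →ₗ[ℝ] Pt d} (hT : LinearMap.det T ≠ 0) (k : ℕ) (ρ : ℝ) (c : Pt d) :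
    ENNReal.ofReal |LinearMap.det T| ^ k * volume (region T k ρ c) =
      volume (Metric.closedBall (0 : Pt d) ρ) := by
  have h : region T k ρ c = (fun x => x + -c) ⁻¹' ((T ^ k) ⁻¹' Metric.closedBall 0 ρ) := by
    ext x
    simp [region, sub_eq_add_neg]
  have hTk : LinearMap.det (T ^ k) ≠ 0 := by
    rw [map_pow]
    exact pow_ne_zero k hT
  rw [h, measure_preimage_add_right, Measure.addHaar_preimage_linearMap _ hTk, ← mul_assoc,
    ← ENNReal.ofReal_pow (abs_nonneg _), ← ENNReal.ofReal_mul (by positivity), map_pow, ← abs_pow,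
    ← abs_mul, mul_inv_cancel₀ (pow_ne_zero k hT), abs_one, ENNReal.ofReal_one, one_mul]

lemma mem_region_add {T : Pt d →ₗ[ℝ] Pt d} {M : ℝ} {k : ℕ} (hM : ∀ x, ‖(T ^ k) x‖ ≤ M * ‖x‖)
    (hM0 : 0 ≤ M) {ρ r : ℝ} {c x y : Pt d} (hx : x ∈ region T k ρ c) (hxy : dist y x ≤ r) :
    y ∈ region T k (ρ + M * r) c := by
  have h : (T ^ k) (y - c) = (T ^ k) (x - c) + (T ^ k) (y - x) := by
    rw [← map_add]
    congr 1
    abel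
  rw [region, Set.mem_ofPred_eq, h]
  refine (norm_add_le _ _).trans (add_le_add hx ((hM _).trans ?_))
  rw [← dist_eq_norm]
  gcongr

/-- Double counting: integrate over `y` in the enlarged region the number of points of `X` in the
ball of radius `r` around `y`. -/
lemma count_region_mul_le {T : Pt d →ₗ[ℝ] Pt d} {M : ℝ} {k : ℕ}
    (hM : ∀ x, ‖(T ^ k) x‖ ≤ M * ‖x‖) (hM0 : 0 ≤ M) {X : PointMultiset d} {r : ℝ} {m : ℕ}
    (hX : ∀ c : Pt d, ∀ F : Finset (Pt d), (F : Set (Pt d)) ⊆ Metric.ball c r → ∑ x ∈ F, X x ≤ m)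
    (ρ : ℝ) (c : Pt d) :
    count X (region T k ρ c) * volume (Metric.ball (0 : Pt d) r) ≤
      m * volume (region T k (ρ + M * r) c) := by
  classical
  rw [count, ← ENNReal.tsum_mul_right, ENNReal.tsum_eq_iSup_sum]
  refine iSup_le fun F => ?_
  set F' := F.filter (· ∈ region T k ρ c)
  calc ∑ x ∈ F, (region T k ρ c).indicator (fun x => (X x : ℝ≥0∞)) x *
        volume (Metric.ball (0 : Pt d) r)
      = ∑ x ∈ F', X x * volume (Metric.ball x r) := by
        rw [Finset.sum_filter]
        refine Finset.sum_congr rfl fun x _ => ?_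
        rw [Set.indicator_apply, Measure.addHaar_ball_center volume x]
        split_ifs <;> simp
    _ = ∑ x ∈ F', ∫⁻ y in region T k (ρ + M * r) c,
          X x * (Metric.ball x r).indicator 1 y := by
        refine Finset.sum_congr rfl fun x hx => ?_
        -- The ball around `x` lies inside the enlarged region, so no volume is lost.
        rw [lintegral_const_mul _ (measurable_one.indicator measurableSet_ball),
          lintegral_indicator_one measurableSet_ball, Measure.restrict_apply measurableSet_ball,
          Set.inter_eq_left.mpr]
        exact fun y hy => mem_region_add hM hM0 (Finset.mem_filter.mp hx).2
          (Metric.mem_ball.mp hy).le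
    _ = ∫⁻ y in region T k (ρ + M * r) c,
          ∑ x ∈ F', X x * (Metric.ball x r).indicator 1 y := by
        rw [lintegral_finsetSum]
        exact fun x _ => (measurable_one.indicator measurableSet_ball).const_mul _
    _ ≤ ∫⁻ y in region T k (ρ + M * r) c, m := by
        refine lintegral_mono fun y => ?_
        have h := hX y (F'.filter (· ∈ Metric.ball y r))
          (fun x hx => (Finset.mem_filter.mp hx).2)
        calc ∑ x ∈ F', (X x : ℝ≥0∞) * (Metric.ball x r).indicator 1 y
            = ((∑ x ∈ F'.filter (· ∈ Metric.ball y r), X x : ℕ) : ℝ≥0∞) := by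
              rw [Finset.sum_filter (· ∈ Metric.ball y r)]
              push_cast
              refine Finset.sum_congr rfl fun x _ => ?_
              rw [Set.indicator_apply, Metric.mem_ball_comm]
              split_ifs <;> simp
          _ ≤ m := by exact_mod_cast h
    _ = m * volume (region T k (ρ + M * r) c) := setLIntegral_const _ _

/-- The balls of radius `R` around the points of `X` in the enlarged region cover the region. -/
lemma volume_region_le_count_mul {T : Pt d →ₗ[ℝ] Pt d} {M : ℝ} {k : ℕ}
    (hM : ∀ x, ‖(T ^ k) x‖ ≤ M * ‖x‖) (hM0 : 0 ≤ M) {X : PointMultiset d} {R : ℝ} (hR : 0 < R)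
    (hX : ∀ c : Pt d, ∃ x ∈ Metric.closedBall c R, 0 < X x) (ρ : ℝ) (c : Pt d) :
    volume (region T k ρ c) ≤
      count X (region T k (ρ + M * R) c) * volume (Metric.closedBall (0 : Pt d) R) := by
  set f := (region T k (ρ + M * R) c).indicator (fun x => (X x : ℝ≥0∞)) with hf
  -- Finiteness of the sum makes the family of balls countable.
  by_cases htop : ∑' x, f x = ⊤
  · have hpos : volume (Metric.closedBall (0 : Pt d) R) ≠ 0 :=
      (Metric.measure_closedBall_pos volume 0 hR).ne'
    rw [count, htop, ENNReal.top_mul hpos]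
    exact le_top
  have hsub : region T k ρ c ⊆ ⋃ x ∈ Function.support f, Metric.closedBall x R := by
    intro y hy
    obtain ⟨x, hxy, hx⟩ := hX y
    refine Set.mem_biUnion (x := x) ?_ (Metric.mem_closedBall_comm.mp hxy)
    have hxr := mem_region_add hM hM0 hy hxy
    rw [Function.mem_support, hf, Set.indicator_of_mem hxr]
    exact_mod_cast hx.ne'
  have hf1 : ∀ x ∈ Function.support f, 1 ≤ f x := fun x hx => by
    have hxr := Set.mem_of_indicator_ne_zero hx
    rw [Function.mem_support, hf, Set.indicator_of_mem hxr] at hx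
    rw [hf, Set.indicator_of_mem hxr]
    exact_mod_cast Nat.one_le_iff_ne_zero.mpr (by exact_mod_cast hx)
  calc volume (region T k ρ c)
      ≤ ∑' x : Function.support f, volume (Metric.closedBall (x : Pt d) R) :=
        (measure_mono hsub).trans
          (measure_biUnion_le volume (Summable.countable_support_ennreal htop) _)
    _ ≤ ∑' x : Function.support f, f x * volume (Metric.closedBall (0 : Pt d) R) := by
        refine ENNReal.tsum_le_tsum fun x => ?_
        rw [Measure.addHaar_closedBall_center]
        exact le_mul_of_one_le_left zero_le (hf1 x x.2)
    _ ≤ count X (region T k (ρ + M * R) c) * volume (Metric.closedBall (0 : Pt d) R) := by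
        rw [ENNReal.tsum_mul_right]
        gcongr
        exact ENNReal.tsum_comp_le_tsum_of_injective Subtype.val_injective f

/-- The inflation functional equation, in terms of numbers of points. -/
lemma count_region_succ {n : ℕ} {A : Matrix (Fin d) (Fin d) ℝ} (hA : A.det ≠ 0)
    {D : Fin n → Fin n → Finset (Pt d)} {X : MultisetFamily d n} (hX : inflate A D X = X)
    (i : Fin n) (k : ℕ) (ρ : ℝ) (c : Pt d) :
    count (X i) (region (Matrix.toEuclideanLin A⁻¹) (k + 1) ρ c) =
      ∑ j, ∑ v ∈ D i j, count (X j) (region (Matrix.toEuclideanLin A⁻¹) k ρ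
        (Matrix.toEuclideanLin A⁻¹ (c - v))) := by
  set T : Pt d →ₗ[ℝ] Pt d := Matrix.toEuclideanLin A⁻¹ with hT
  have hdet : LinearMap.det T ≠ 0 := by
    rw [hT, LinearMap.det_toLpLin, Matrix.det_nonsing_inv, Ring.inverse_eq_inv']
    exact inv_ne_zero hA
  have hXi : ∀ x, (X i x : ℝ≥0∞) = ∑ j, ∑ v ∈ D i j, (X j (T (x - v)) : ℝ≥0∞) := fun x => by
    conv_lhs => rw [← hX]
    simp [inflate, PointMultiset.addSet, PointMultiset.image, hT]
  have hind : ∀ x, (region T (k + 1) ρ c).indicator (fun x => (X i x : ℝ≥0∞)) x =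
      ∑ j, ∑ v ∈ D i j,
        (region T k ρ (T (c - v))).indicator (fun x => (X j x : ℝ≥0∞)) (T (x - v)) := fun x => by
    have hmem : ∀ v, T (x - v) ∈ region T k ρ (T (c - v)) ↔ x ∈ region T (k + 1) ρ c := fun v => by
      rw [region, region, Set.mem_ofPred_eq, Set.mem_ofPred_eq, ← map_sub, sub_sub_sub_cancel_right,
        pow_succ, Module.End.mul_apply]
    by_cases hx : x ∈ region T (k + 1) ρ c
    · rw [Set.indicator_of_mem hx, hXi]
      exact Finset.sum_congr rfl fun j _ => Finset.sum_congr rfl fun v _ =>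
        (Set.indicator_of_mem ((hmem v).mpr hx) fun x => (X j x : ℝ≥0∞)).symm
    · rw [Set.indicator_of_notMem hx]
      exact (Finset.sum_eq_zero fun j _ => Finset.sum_eq_zero fun v _ =>
        Set.indicator_of_notMem (fun h => hx ((hmem v).mp h)) _).symm
  simp_rw [count, hind]
  rw [Summable.tsum_finsetSum fun _ _ => ENNReal.summable]
  refine Finset.sum_congr rfl fun j _ => ?_
  rw [Summable.tsum_finsetSum fun _ _ => ENNReal.summable]
  refine Finset.sum_congr rfl fun v _ => ?_
  -- Reindex along the bijection `x ↦ T (x - v)`.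
  exact ((Equiv.subRight v).trans (T.equivOfDetNeZero hdet).toEquiv).tsum_eq
    ((region T k ρ (T (c - v))).indicator fun x => (X j x : ℝ≥0∞))

end Inflation

/-! ### Comparison of growth rates -/

namespace Inflation

variable {d n : ℕ} {A : Matrix (Fin d) (Fin d) ℝ} {D : Fin n → Fin n → Finset (Pt d)}
  {X : MultisetFamily d n} {τ : ℝ≥0∞} {V : Fin n → ℝ≥0∞}

/-- Here `τ` is an eigenvalue of the subdivision matrix with eigenvector `V`; since the bound is
uniform in the centre `c`, it survives each application of the functional equation. -/
lemma count_region_le_pow (hA : A.det ≠ 0) (hX : inflate A D X = X)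
    (hV : ∀ i, ∑ j, (D i j).card * V j = τ * V i) {ρ : ℝ} {C : ℝ≥0∞}
    (h0 : ∀ i c, count (X i) (region (Matrix.toEuclideanLin A⁻¹) 0 ρ c) ≤ C * V i) (k : ℕ) :
    ∀ i c, count (X i) (region (Matrix.toEuclideanLin A⁻¹) k ρ c) ≤ C * τ ^ k * V i := by
  induction k with
  | zero => simpa using h0
  | succ k ih =>
    intro i c
    rw [count_region_succ hA hX]
    calc _ ≤ ∑ j, ∑ _v ∈ D i j, C * τ ^ k * V j :=
          Finset.sum_le_sum fun j _ => Finset.sum_le_sum fun v _ => ih j _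
      _ = C * τ ^ k * ∑ j, (D i j).card * V j := by
          rw [Finset.mul_sum]
          refine Finset.sum_congr rfl fun j _ => ?_
          rw [Finset.sum_const, nsmul_eq_mul]
          ring
      _ = C * τ ^ (k + 1) * V i := by rw [hV]; ring

lemma pow_le_count_region (hA : A.det ≠ 0) (hX : inflate A D X = X)
    (hV : ∀ i, ∑ j, (D i j).card * V j = τ * V i) {ρ : ℝ} {C : ℝ≥0∞}
    (h0 : ∀ i c, C * V i ≤ count (X i) (region (Matrix.toEuclideanLin A⁻¹) 0 ρ c)) (k : ℕ) :
    ∀ i c, C * τ ^ k * V i ≤ count (X i) (region (Matrix.toEuclideanLin A⁻¹) k ρ c) := by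
  induction k with
  | zero => simpa using h0
  | succ k ih =>
    intro i c
    rw [count_region_succ hA hX]
    calc C * τ ^ (k + 1) * V i = C * τ ^ k * ∑ j, (D i j).card * V j := by rw [hV]; ring
      _ = ∑ j, ∑ _v ∈ D i j, C * τ ^ k * V j := by
          rw [Finset.mul_sum]
          refine Finset.sum_congr rfl fun j _ => ?_
          rw [Finset.sum_const, nsmul_eq_mul]
          ring
      _ ≤ _ := Finset.sum_le_sum fun j _ => Finset.sum_le_sum fun v _ => ih j _

lemma one_le_of_forall_le_mul_pow {a C x : ℝ≥0∞} (ha : a ≠ 0) (hC : C ≠ ⊤)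
    (h : ∀ k : ℕ, a ≤ C * x ^ k) : 1 ≤ x := by
  by_contra hx
  have h1 := ENNReal.Tendsto.const_mul
    (ENNReal.tendsto_pow_atTop_nhds_zero_of_lt_one (not_le.mp hx)) (Or.inr hC)
  rw [mul_zero] at h1
  exact ha (le_zero_iff.mp (ge_of_tendsto' h1 h))

lemma le_one_of_forall_mul_pow_le {a C x : ℝ≥0∞} (ha : a ≠ 0) (hC : C ≠ ⊤)
    (h : ∀ k : ℕ, a * x ^ k ≤ C) : x ≤ 1 := by
  by_contra hx
  have h1 := ENNReal.Tendsto.const_mul (a := a)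
    (ENNReal.tendsto_pow_atTop_nhds_top_iff.mpr (not_le.mp hx)) (Or.inl ENNReal.top_ne_zero)
  rw [ENNReal.mul_top ha] at h1
  exact hC (top_le_iff.mp (le_of_tendsto' h1 h))

/-- A weak Delone multiset has, up to bounded factors, as many points in an inflated ball as the
volume of that ball. -/
lemma IsWeakDelone.exists_count_region_bounds {Y : PointMultiset d} (hY : IsWeakDelone Y)
    {T : Pt d →ₗ[ℝ] Pt d} (hT : LinearMap.det T ≠ 0) {M : ℝ} (hM0 : 0 ≤ M)
    (hM : ∀ (k : ℕ) (x : Pt d), ‖(T ^ k) x‖ ≤ M * ‖x‖) :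
    (∀ ρ, ∃ C : ℝ≥0∞, C ≠ ⊤ ∧
      ∀ k c, ENNReal.ofReal |LinearMap.det T| ^ k * count Y (region T k ρ c) ≤ C) ∧
    (∃ ρ, ∃ a : ℝ≥0∞, a ≠ 0 ∧
      ∀ k c, a ≤ ENNReal.ofReal |LinearMap.det T| ^ k * count Y (region T k ρ c)) := by
  set δ := ENNReal.ofReal |LinearMap.det T|
  refine ⟨fun ρ => ?_, ?_⟩
  · obtain ⟨r, hr, m, -, hm⟩ := hY.weaklyUniformlyDiscrete
    have hb0 : volume (Metric.ball (0 : Pt d) r) ≠ 0 := (Metric.measure_ball_pos volume 0 hr).ne'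
    refine ⟨m * volume (Metric.closedBall (0 : Pt d) (ρ + M * r)) /
      volume (Metric.ball (0 : Pt d) r),
      ENNReal.div_ne_top (ENNReal.mul_ne_top (ENNReal.natCast_ne_top m)
        measure_closedBall_lt_top.ne) hb0, fun k c => ?_⟩
    rw [ENNReal.le_div_iff_mul_le (Or.inl hb0) (Or.inl measure_ball_lt_top.ne), mul_assoc,
      ← volume_region hT k (ρ + M * r) c,
      mul_left_comm (m : ℝ≥0∞)]
    exact mul_le_mul' le_rfl (count_region_mul_le (hM k) hM0 hm ρ c)
  · obtain ⟨R, hR, hRd⟩ := hY.relativelyDense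
    have hb : volume (Metric.closedBall (0 : Pt d) R) ≠ 0 :=
      (Metric.measure_closedBall_pos volume 0 hR).ne'
    refine ⟨1 + M * R, volume (Metric.closedBall (0 : Pt d) 1) /
      volume (Metric.closedBall (0 : Pt d) R),
      ENNReal.div_ne_zero.mpr ⟨(Metric.measure_closedBall_pos volume 0 one_pos).ne',
        measure_closedBall_lt_top.ne⟩, fun k c => ?_⟩
    rw [ENNReal.div_le_iff hb measure_closedBall_lt_top.ne, ← volume_region hT k 1 c, mul_assoc]
    gcongr
    exact volume_region_le_count_mul (hM k) hM0 hR hRd 1 c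

/-- The numbers of points of the `X i` in the balls inflated by `A ^ k` grow like `t ^ k` by the
functional equation and like `|det A| ^ k` by the Delone property. -/
theorem IsWeakDeloneFamily.eq_abs_det (hd : 0 < d) (hn : 0 < n) (hA : IsExpanding A)
    (hX : IsWeakDeloneFamily A D X) {t : ℝ} (ht : 0 < t) {v : Fin n → ℝ} (hv : ∀ i, 0 < v i)
    (hSv : subdivisionMatrix D *ᵥ v = t • v) : t = |A.det| := by
  have hdet := hA.det_ne_zero
  obtain ⟨M, hM0, hM⟩ := hA.exists_norm_pow_inv_le hd
  have hdetT : LinearMap.det (Matrix.toEuclideanLin A⁻¹ : Pt d →ₗ[ℝ] Pt d) = A.det⁻¹ := by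
    rw [LinearMap.det_toLpLin, Matrix.det_nonsing_inv, Ring.inverse_eq_inv']
  have hT : LinearMap.det (Matrix.toEuclideanLin A⁻¹ : Pt d →ₗ[ℝ] Pt d) ≠ 0 := by
    rw [hdetT]
    exact inv_ne_zero hdet
  set V : Fin n → ℝ≥0∞ := fun i => ENNReal.ofReal (v i) with hVdef
  set τ := ENNReal.ofReal t
  have hV0 : ∀ i, V i ≠ 0 := fun i => (ENNReal.ofReal_pos.mpr (hv i)).ne'
  have hVt : ∀ i, V i ≠ ⊤ := fun i => ENNReal.ofReal_ne_top
  have hV : ∀ i, ∑ j, (D i j).card * V j = τ * V i := fun i => by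
    have h : ∑ j, ((D i j).card : ℝ) * v j = t * v i := congrFun hSv i
    rw [← ENNReal.ofReal_mul ht.le, ← h, ENNReal.ofReal_sum_of_nonneg
      fun j _ => mul_nonneg (Nat.cast_nonneg _) (hv j).le]
    refine Finset.sum_congr rfl fun j _ => ?_
    rw [ENNReal.ofReal_mul (Nat.cast_nonneg _)]
    simp [hVdef]
  have hbd := fun i => (hX.isWeakDelone i).exists_count_region_bounds hT hM0 hM
  set T : Pt d →ₗ[ℝ] Pt d := Matrix.toEuclideanLin A⁻¹
  set δ := ENNReal.ofReal |LinearMap.det T|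
  let i₀ : Fin n := ⟨0, hn⟩
  have hge : 1 ≤ δ * τ := by
    obtain ⟨ρ, a, ha, hlow⟩ := (hbd i₀).2
    choose C hC hup using fun i => (hbd i).1 ρ
    -- `∑ i, C i / V i` is a factor `c` with `C i ≤ c * V i` for all `i` at once.
    have hCV : ∑ i, C i / V i ≠ ⊤ := ENNReal.sum_ne_top.mpr fun i _ =>
      ENNReal.div_ne_top (hC i) (hV0 i)
    refine one_le_of_forall_le_mul_pow (C := (∑ i, C i / V i) * V i₀) ha
      (ENNReal.mul_ne_top hCV (hVt i₀)) fun k => ?_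
    calc a ≤ δ ^ k * count (X i₀) (region T k ρ 0) := hlow k 0
      _ ≤ δ ^ k * ((∑ i, C i / V i) * τ ^ k * V i₀) := by
        gcongr
        refine count_region_le_pow hdet hX.inflate_eq hV (fun i c => ?_) k i₀ 0
        calc count (X i) (region T 0 ρ c) ≤ C i := by simpa using hup i 0 c
          _ = C i / V i * V i := (ENNReal.div_mul_cancel (hV0 i) (hVt i)).symm
          _ ≤ (∑ i, C i / V i) * V i := by
            gcongr
            exact Finset.single_le_sum (f := fun i => C i / V i) (fun _ _ => zero_le)
              (Finset.mem_univ i)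
      _ = (∑ i, C i / V i) * V i₀ * (δ * τ) ^ k := by ring
  have hle : δ * τ ≤ 1 := by
    choose ρ a ha hlow using fun i => (hbd i).2
    -- Each `X i` comes with its own radius; counting is monotone in the radius, so take the largest.
    obtain ⟨ρ', hρ'⟩ := (Set.finite_range ρ).bddAbove
    obtain ⟨C, hC, hup⟩ := (hbd i₀).1 ρ'
    have : Nonempty (Fin n) := ⟨i₀⟩
    obtain ⟨i₁, hi₁⟩ := Finite.exists_min (α := Fin n) fun i => a i / V i
    have hb : a i₁ / V i₁ ≠ 0 := ENNReal.div_ne_zero.mpr ⟨ha i₁, hVt i₁⟩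
    refine le_one_of_forall_mul_pow_le (a := a i₁ / V i₁ * V i₀) (mul_ne_zero hb (hV0 i₀)) hC
      fun k => ?_
    calc a i₁ / V i₁ * V i₀ * (δ * τ) ^ k = δ ^ k * (a i₁ / V i₁ * τ ^ k * V i₀) := by ring
      _ ≤ δ ^ k * count (X i₀) (region T k ρ' 0) := by
        gcongr
        refine pow_le_count_region hdet hX.inflate_eq hV (fun i c => ?_) k i₀ 0
        calc a i₁ / V i₁ * V i ≤ a i / V i * V i := mul_le_mul' (hi₁ i) le_rfl
          _ = a i := ENNReal.div_mul_cancel (hV0 i) (hVt i)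
          _ ≤ count (X i) (region T 0 (ρ i) c) := by simpa using hlow i 0 c
          _ ≤ count (X i) (region T 0 ρ' c) := by
            refine ENNReal.tsum_le_tsum fun x => ?_
            refine Set.indicator_le_indicator_of_subset (fun y hy => ?_) (fun _ => zero_le) x
            exact le_trans (show ‖(T ^ 0) (y - c)‖ ≤ ρ i from hy) (hρ' ⟨i, rfl⟩)
      _ ≤ C := hup k 0
  have h1 : δ * τ = 1 := le_antisymm hle hge
  rw [← ENNReal.ofReal_mul (abs_nonneg _), ENNReal.ofReal_eq_one, hdetT, abs_inv] at h1
  exact (eq_of_inv_mul_eq_one h1).symm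

end Inflation

theorem mainTheorem2 {d n : ℕ} (hd : 0 < d) (hn : 0 < n)
    (A : Matrix (Fin d) (Fin d) ℝ) (hA : Inflation.IsExpanding A)
    (D : Fin n → Fin n → Finset (Inflation.Pt d))
    (hS : (Inflation.subdivisionMatrix D).IsPrimitive)
    (hX : ∃ X : Inflation.MultisetFamily d n, Inflation.IsWeakDeloneFamily A D X) :
    Inflation.IsPerronEigenvalue (Inflation.subdivisionMatrix D) |A.det| := by
  have : NeZero n := ⟨hn.ne'⟩
  obtain ⟨X, hX⟩ := hX
  obtain ⟨t, ht, ⟨v, hv, hSv⟩, w, hw, hwS⟩ := hS.exists_left_right_eigenvectors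
  rw [← hX.eq_abs_det hd hn hA ht hv hSv]
  exact Inflation.isPerronEigenvalue_of_isPrimitive hS ht hv hSv hw hwS
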